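/- Let $X$ be a real or complex Banach space, let $1<\alpha<2$, and for $\beta>0$, $t>0$ put $g_\beta(t)=t^{\beta-1}/\Gamma(\beta)$ and $(g_\beta*f)(t)=\int_0^t g_\beta(t-s)f(s)\,ds$. Let $A$ be a closed, densely defined linear operator on $X$, and let $\{S_\alpha(t)\}_{t\ge 0}\subset B(X)$ be an $\alpha$-times resolvent family generated by $A$, that is: (a) $S_\alpha(\cdot)$ is strongly continuous on $[0,\infty)$ and $S_\alpha(0)=I$; (b) $S_\alpha(t)D(A)\subset D(A)$ and $AS_\alpha(t)x=S_\alpha(t)Ax$ for all $x\in D(A)$, $t\ge 0$; (c) $S_\alpha(t)x=x+\int_0^t g_\alpha(t-s)S_\alpha(s)Ax\,ds$ for all $x\in D(A)$, $t\ge 0$. Define $$P_\alpha(t)x=(g_{\alpha-1}*S_\alpha)(t)x=\int_0^t g_{\alpha-1}(t-s)S_\alpha(s)x\,ds\qquad(x\in X,\ t\ge 0).$$ Let $r>0$ and suppose that $S_\alpha(\cdot)$ is of bounded semivariation on $[0,r]$, that is, $$\sup\Big\{\Big\|\sum_{i=1}^n[S_\alpha(d_i)-S_\alpha(d_{i-1})]x_i\Big\|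 : n\ge 1,\ 0=d_0<d_1<\dots<d_n=r,\ x_i\in X,\ \|x_i\|\le 1\Big\}<\infty.$$ Then for every $t\in[0,r]$ the range of $P_\alpha(t)$ is contained in $D(A)$, the operator $AP_\alpha(t)$ is a bounded linear operator on $X$, and $\sup_{t\in[0,r]}\|t\,AP_\alpha(t)\|<\infty$. -/

import Mathlib

open Set
open scoped ENNReal

noncomputable section

namespace FractionalResolvent

/-- The kernel `g_β(t) = t^(β-1) / Γ(β)`, used for `β > 0` and `t > 0`. -/
def fracKernel (β t : ℝ) : ℝ := t ^ (β - 1) / Real.Gamma β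

/-- The convolution `(g_β * f)(t) = ∫_0^t g_β(t-s) f(s) ds`. -/
def fracConv {X : Type*} [NormedAddCommGroup X] [NormedSpace ℝ X]
    (β : ℝ) (f : ℝ → X) (t : ℝ) : X :=
  ∫ s in (0 : ℝ)..t, fracKernel β (t - s) • f s

/-- `S` (of which only the values at `t ≥ 0` matter) is an `α`-times resolvent family generated by
the closed, densely defined linear operator `A`. -/
structure IsResolventFamily {𝕜 X : Type*} [RCLike 𝕜] [NormedAddCommGroup X] [NormedSpace 𝕜 X]
    [NormedSpace ℝ X] (α : ℝ) (A : X →ₗ.[𝕜] X) (S : ℝ → X →L[𝕜] X) : Prop where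
  isClosed : A.IsClosed
  dense_domain : Dense (A.domain : Set X)
  strongly_continuous : ∀ x : X, ContinuousOn (fun t => S t x) (Ici 0)
  map_zero : S 0 = ContinuousLinearMap.id 𝕜 X
  commute : ∀ t : ℝ, 0 ≤ t → ∀ x : A.domain,
    ∃ h : S t (x : X) ∈ A.domain, A ⟨S t (x : X), h⟩ = S t (A x)
  resolvent_eq : ∀ x : A.domain, ∀ t : ℝ, 0 ≤ t →
    S t (x : X) = (x : X) + fracConv α (fun s => S s (A x)) t

/-- The operators `P_α(t) x = (g_{α-1} * S)(t) x`. -/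
def resolventP {𝕜 X : Type*} [RCLike 𝕜] [NormedAddCommGroup X] [NormedSpace 𝕜 X]
    [NormedSpace ℝ X] (α : ℝ) (S : ℝ → X →L[𝕜] X) (t : ℝ) (x : X) : X :=
  fracConv (α - 1) (fun s => S s x) t

/-- A subdivision `a = d_0 < d_1 < ⋯ < d_n = b` (the values `pt i` for `i > n` play no role). -/
structure Subdivision (a b : ℝ) where
  n : ℕ
  pt : ℕ → ℝ
  pt_zero : pt 0 = a
  pt_last : pt n = b
  pt_lt : ∀ i, i < n → pt i < pt (i + 1)

/-- `SV_d[G]`, the supremum of `‖∑ (G(d_{i+1}) - G(d_i)) x_i‖` over all `x_i` in the closed unit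
ball. -/
def semivariationOn {𝕜 X : Type*} [RCLike 𝕜] [NormedAddCommGroup X] [NormedSpace 𝕜 X]
    {a b : ℝ} (G : ℝ → X →L[𝕜] X) (d : Subdivision a b) : ℝ≥0∞ :=
  ⨆ (x : ℕ → X) (_ : ∀ i, ‖x i‖ ≤ 1),
    ‖∑ i ∈ Finset.range d.n, (G (d.pt (i + 1)) - G (d.pt i)) (x i)‖ₑ

/-- The semivariation `SV[G]` on `[a, b]`. -/
def semivariation {𝕜 X : Type*} [RCLike 𝕜] [NormedAddCommGroup X] [NormedSpace 𝕜 X]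
    (G : ℝ → X →L[𝕜] X) (a b : ℝ) : ℝ≥0∞ :=
  ⨆ d : Subdivision a b, semivariationOn G d

/-- `G` is of bounded semivariation on `[a, b]`. -/
def HasBoundedSemivariation {𝕜 X : Type*} [RCLike 𝕜] [NormedAddCommGroup X] [NormedSpace 𝕜 X]
    (G : ℝ → X →L[𝕜] X) (a b : ℝ) : Prop :=
  semivariation G a b < ⊤

end FractionalResolvent

end

/-! The heart of the matter is the identity `t P(t) x = α ∫_0^t P(t-s) S(s) x ds`. For `x ∈ D(A)`,
the integral of `(t-s) P(t-s) S(s) x` over `[0, t]` can be computed in two ways: by expanding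
`S(s) x = x + (g_α * S A x)(s)`, or by applying
`v P(v) z = α ∫_0^v P(w) z dw + (g_α * (w ↦ w P(w) A z))(v)`, which comes from
`v g_α(v) = α g_{α+1}(v)`, to `v = t - s` and `z = S(s) x`. Both computations produce the same
convolution involving `A x`, and comparing what remains gives the identity integrated over `[0, t]`;
differentiation and density do the rest.

For `y = A x` one has `S(d) x - S(c) x = ∫_c^d P(u) y du`, so that `∫_0^t P(u) S(t-u) y du` is a
limit of the Riemann–Stieltjes sums `∑ (S(d_{i+1}) - S(d_i)) S(t-d_i) x`. Such sums are bounded by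
the semivariation of `S` times `sup ‖S‖ ‖x‖`. Hence `t P(t) A` is bounded on the dense subspace
`D(A)`, uniformly in `t`, and since `A` is closed its bounded extension to `X` is `t A P(t)`. -/

open MeasureTheory Filter Topology

namespace FractionalResolvent

section KernelIntegrals

variable {E : Type*} [NormedAddCommGroup E] [NormedSpace ℝ E] {k : ℝ → ℝ}

theorem intervalIntegrable_kernel_smul (hk : ∀ a b, IntervalIntegrable k volume a b)
    {f : ℝ → E} (hf : Continuous f) (t a b : ℝ) :
    IntervalIntegrable (fun s => k (t - s) • f s) volume a b := by
  have hk_sub : IntervalIntegrable (fun s => k (t - s)) volume a b := by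
    simpa only [sub_sub_cancel] using (hk (t - a) (t - b)).comp_sub_left t
  exact hk_sub.smul_continuousOn hf.continuousOn

theorem integral_kernel_comm (k : ℝ → ℝ) (f : ℝ → E) (t : ℝ) :
    ∫ s in (0 : ℝ)..t, k (t - s) • f s = ∫ s in (0 : ℝ)..t, k s • f (t - s) := by
  simpa using intervalIntegral.integral_comp_sub_left (a := 0) (b := t)
    (fun s => k s • f (t - s)) t

theorem continuous_integral_kernel_smul (hk : ∀ a b, IntervalIntegrable k volume a b)
    {Z : Type*} [TopologicalSpace Z] [FirstCountableTopology Z] {φ : Z → ℝ → E}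
    (hφ : Continuous (Function.uncurry φ)) {b : Z → ℝ} (hb : Continuous b) :
    Continuous fun z => ∫ s in (0 : ℝ)..b z, k s • φ z s := by
  rw [continuous_iff_continuousAt]
  intro z₀
  set R := |b z₀| + 1
  obtain ⟨C, hC⟩ := (isCompact_Icc (a := -R) (b := R)).exists_bound_of_continuousOn
    (hφ.comp (Continuous.prodMk_right z₀)).continuousOn
  have hbound : ∀ᶠ z in 𝓝 z₀, ∀ s ∈ Icc (-R) R, ‖φ z s‖ < C + 1 := by
    refine isCompact_Icc.eventually_forall_of_forall_eventually fun s hs => ?_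
    have hlt : ‖Function.uncurry φ (z₀, s)‖ < C + 1 := (hC s hs).trans_lt (lt_add_one C)
    exact hφ.norm.continuousAt.eventually (gt_mem_nhds hlt)
  have hφz : ∀ z, Continuous (φ z) := fun z => hφ.comp (Continuous.prodMk_right z)
  have hprim := intervalIntegral.continuousAt_parametric_primitive_of_dominated
    (μ := volume) (F := fun z s => k s • φ z s) (fun s => ‖k s‖ * (C + 1))
    (-R) R (a₀ := 0) (b₀ := b z₀) (x₀ := z₀)
    (fun z => ((hk _ _).smul_continuousOn (hφz z).continuousOn).def'.aestronglyMeasurable)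
    (by
      filter_upwards [hbound] with z hz
      refine (ae_restrict_iff' measurableSet_uIoc).2 (Eventually.of_forall fun s hs => ?_)
      rw [uIoc_of_le (neg_le_self (by positivity))] at hs
      rw [norm_smul]
      exact mul_le_mul_of_nonneg_left (hz s (Ioc_subset_Icc_self hs)).le (norm_nonneg _))
    ((hk _ _).norm.mul_const _)
    (Eventually.of_forall fun s =>
      ((hφ.comp (Continuous.prodMk_left s)).const_smul (k s)).continuousAt)
    ⟨neg_neg_iff_pos.2 (by positivity), by positivity⟩
    (abs_lt.1 (lt_add_one _)) (measure_singleton _)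
  exact hprim.comp (f := fun z => (z, b z)) (by fun_prop)

theorem integral_integral_triangle_swap {φ : ℝ → ℝ → E} {t : ℝ} (ht : 0 ≤ t)
    (hφ : IntegrableOn (Function.uncurry φ) (Ioc 0 t ×ˢ Ioc 0 t)) :
    ∫ s in (0 : ℝ)..t, ∫ u in (0 : ℝ)..s, φ s u = ∫ u in (0 : ℝ)..t, ∫ s in u..t, φ s u := by
  let ψ : ℝ → ℝ → E := fun s u => {p : ℝ × ℝ | p.2 < p.1}.indicator (Function.uncurry φ) (s, u)
  have hψ : Integrable (Function.uncurry ψ)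
      ((volume.restrict (Ioc 0 t)).prod (volume.restrict (Ioc 0 t))) := by
    rw [Measure.prod_restrict, ← Measure.volume_eq_prod]
    exact hφ.integrable.indicator (measurableSet_lt measurable_snd measurable_fst)
  have hfst : ∀ s ∈ Ioc 0 t, ∫ u in (0 : ℝ)..s, φ s u = ∫ u in Ioc 0 t, ψ s u := by
    intro s hs
    have hsection : ψ s = (Iio s).indicator (φ s) := rfl
    have hset : Ioc 0 t ∩ Iio s = Ioo 0 s := by
      ext u
      exact ⟨fun h => ⟨h.1.1, h.2⟩, fun h => ⟨⟨h.1, h.2.le.trans hs.2⟩, h.2⟩⟩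
    rw [hsection, setIntegral_indicator measurableSet_Iio, hset,
      intervalIntegral.integral_of_le hs.1.le, integral_Ioc_eq_integral_Ioo]
  have hsnd : ∀ u ∈ Ioc 0 t, ∫ s in u..t, φ s u = ∫ s in Ioc 0 t, ψ s u := by
    intro u hu
    have hsection : (fun s => ψ s u) = (Ioi u).indicator fun s => φ s u := rfl
    have hset : Ioc 0 t ∩ Ioi u = Ioc u t := by
      ext s
      exact ⟨fun h => ⟨h.2, h.1.2⟩, fun h => ⟨⟨hu.1.trans h.1, h.2⟩, h.1⟩⟩
    rw [hsection, setIntegral_indicator measurableSet_Ioi, hset,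
      intervalIntegral.integral_of_le hu.2]
  rw [intervalIntegral.integral_of_le ht, intervalIntegral.integral_of_le ht,
    setIntegral_congr_fun measurableSet_Ioc hfst, setIntegral_congr_fun measurableSet_Ioc hsnd]
  exact integral_integral_swap hψ

theorem integrableOn_kernel_smul_prod (hk : ∀ a b, IntervalIntegrable k volume a b)
    {φ : ℝ → ℝ → E} (hφ : Continuous (Function.uncurry φ)) (t : ℝ) :
    IntegrableOn (fun p : ℝ × ℝ => k (t - p.1) • φ p.1 p.2) (Ioc 0 t ×ˢ Ioc 0 t) := by
  have hk_sub : IntegrableOn (fun s => k (t - s)) (Icc 0 t) := by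
    rcases le_or_gt 0 t with ht | ht
    · have := (hk t 0).comp_sub_left t
      simp only [sub_self, sub_zero] at this
      exact (intervalIntegrable_iff_integrableOn_Icc_of_le ht).1 this
    · simp [Icc_eq_empty_of_lt ht]
  have hk_prod : IntegrableOn (fun p : ℝ × ℝ => k (t - p.1)) (Icc 0 t ×ˢ Icc 0 t) := by
    rw [IntegrableOn, Measure.volume_eq_prod, ← Measure.prod_restrict]
    exact Integrable.comp_fst hk_sub (volume.restrict (Icc 0 t))
  exact (hk_prod.smul_continuousOn hφ.continuousOn (isCompact_Icc.prod isCompact_Icc)).mono_set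
    (prod_mono Ioc_subset_Icc_self Ioc_subset_Icc_self)

theorem integral_kernel_smul_integral_eq_snd (hk : ∀ a b, IntervalIntegrable k volume a b)
    {φ : ℝ → ℝ → E} (hφ : Continuous (Function.uncurry φ)) {t : ℝ} (ht : 0 ≤ t) :
    ∫ s in (0 : ℝ)..t, k (t - s) • ∫ u in (0 : ℝ)..s, φ (s - u) u =
      ∫ u in (0 : ℝ)..t, ∫ v in (0 : ℝ)..(t - u), k (t - u - v) • φ v u := by
  have hshift : Continuous (Function.uncurry fun s u => φ (s - u) u) :=
    hφ.comp (f := fun p : ℝ × ℝ => (p.1 - p.2, p.2)) (by fun_prop)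
  have hswap := integral_integral_triangle_swap ht (φ := fun s u => k (t - s) • φ (s - u) u)
    (integrableOn_kernel_smul_prod hk hshift t)
  simp only [intervalIntegral.integral_smul] at hswap
  rw [hswap]
  refine intervalIntegral.integral_congr fun u _ => ?_
  simpa [sub_sub] using (intervalIntegral.integral_comp_sub_right (a := u) (b := t)
    (fun v => k (t - u - v) • φ v u) u)

theorem integral_kernel_smul_integral_eq_fst (hk : ∀ a b, IntervalIntegrable k volume a b)
    {φ : ℝ → ℝ → E} (hφ : Continuous (Function.uncurry φ)) {t : ℝ} (ht : 0 ≤ t) :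
    ∫ s in (0 : ℝ)..t, k (t - s) • ∫ u in (0 : ℝ)..s, φ (s - u) u =
      ∫ v in (0 : ℝ)..t, ∫ u in (0 : ℝ)..(t - v), k (t - v - u) • φ v u := by
  rw [← integral_kernel_smul_integral_eq_snd hk (φ := fun u v => φ v u)
    (hφ.comp continuous_swap) ht]
  refine intervalIntegral.integral_congr fun s _ => ?_
  have hreflect := integral_kernel_comm (fun _ => 1) (fun u => φ (s - u) u) s
  simp only [one_smul, sub_sub_cancel] at hreflect
  simp only [hreflect]

theorem eq_of_forall_integral_eq [CompleteSpace E] {f g : ℝ → E} (hf : Continuous f)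
    (hg : Continuous g) (h : ∀ t, 0 ≤ t → ∫ s in (0 : ℝ)..t, f s = ∫ s in (0 : ℝ)..t, g s)
    {t : ℝ} (ht : 0 ≤ t) : f t = g t := by
  have hf' := (hf.integral_hasStrictDerivAt 0 t).hasDerivAt.hasDerivWithinAt (s := Ici t)
  have hg' := (hg.integral_hasStrictDerivAt 0 t).hasDerivAt.hasDerivWithinAt (s := Ici t)
  exact (uniqueDiffOn_Ici t t self_mem_Ici).eq_deriv _ hf'
    (hg'.congr (fun u hu => h u (ht.trans hu)) (h t ht))

end KernelIntegrals

section StronglyContinuous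

variable {𝕜 X : Type*} [NontriviallyNormedField 𝕜] [NormedAddCommGroup X] [NormedSpace 𝕜 X]
  [CompleteSpace X] {F : ℝ → X →L[𝕜] X}

theorem exists_norm_le_of_strongly_continuous (hF : ∀ x, Continuous fun t => F t x) (a b : ℝ) :
    ∃ C, ∀ t ∈ Icc a b, ‖F t‖ ≤ C := by
  obtain ⟨C, hC⟩ := banach_steinhaus (g := fun t : Icc a b => F t) fun x =>
    let ⟨C, hC⟩ := isCompact_Icc.exists_bound_of_continuousOn (hF x).continuousOn
    ⟨C, fun t => hC t t.2⟩
  exact ⟨C, fun t ht => hC ⟨t, ht⟩⟩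

theorem continuous_uncurry_of_strongly_continuous (hF : ∀ x, Continuous fun t => F t x) :
    Continuous fun p : ℝ × X => F p.1 p.2 := by
  rw [continuous_iff_continuousAt]
  rintro ⟨t₀, x₀⟩
  obtain ⟨C, hC⟩ := exists_norm_le_of_strongly_continuous hF (t₀ - 1) (t₀ + 1)
  have hcont : ContinuousOn (fun p : ℝ × X => F p.1 p.2) (Icc (t₀ - 1) (t₀ + 1) ×ˢ univ) := by
    refine continuousOn_prod_of_continuousOn_lipschitzOnWith' _ C.toNNReal (fun t ht => ?_)
      fun x _ => (hF x).continuousOn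
    exact ((F t).lipschitz.weaken (NNReal.le_toNNReal_of_coe_le (hC t ht))).lipschitzOnWith
  exact hcont.continuousAt (prod_mem_nhds (Icc_mem_nhds (by linarith) (by linarith)) univ_mem)

end StronglyContinuous

section ClosedOperators

theorem integral_mem_of_isClosed {Ω E : Type*} [MeasurableSpace Ω] {μ : Measure Ω}
    [NormedAddCommGroup E] [NormedSpace ℝ E] [CompleteSpace E] {V : Submodule ℝ E}
    (hV : IsClosed (V : Set E)) {f : Ω → E} (hf : ∀ᵐ ω ∂μ, f ω ∈ V) : ∫ ω, f ω ∂μ ∈ V := by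
  by_cases hint : Integrable f μ
  · have hquot : ∫ ω, V.mkQL (f ω) ∂μ = 0 :=
      integral_eq_zero_of_ae (hf.mono fun ω hω => (Submodule.Quotient.mk_eq_zero V).2 hω)
    rw [V.mkQL.integral_comp_comm hint] at hquot
    exact (Submodule.Quotient.mk_eq_zero V).1 hquot
  · rw [integral_undef hint]
    exact V.zero_mem

theorem intervalIntegral_mem_graph_of_isClosed {𝕜 X : Type*} [NontriviallyNormedField 𝕜]
    [Algebra ℝ 𝕜] [NormedAddCommGroup X] [NormedSpace 𝕜 X] [NormedSpace ℝ X] [IsScalarTower ℝ 𝕜 X]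
    [CompleteSpace X] {A : X →ₗ.[𝕜] X} (hA : A.IsClosed) {f g : ℝ → X} {a b : ℝ} (hab : a ≤ b)
    (hf : IntervalIntegrable f volume a b) (hg : IntervalIntegrable g volume a b)
    (h : ∀ s ∈ Icc a b, (f s, g s) ∈ A.graph) :
    (∫ s in a..b, f s, ∫ s in a..b, g s) ∈ A.graph := by
  rw [intervalIntegral.integral_of_le hab, intervalIntegral.integral_of_le hab,
    ← integral_pair hf.1 hg.1]
  refine integral_mem_of_isClosed (V := A.graph.restrictScalars ℝ) hA ?_
  exact (ae_restrict_iff' measurableSet_Ioc).2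
    (Eventually.of_forall fun s hs => h s (Ioc_subset_Icc_self hs))

theorem exists_clm_comp_of_commute_of_le {𝕜 X : Type*} [NontriviallyNormedField 𝕜]
    [NormedAddCommGroup X] [NormedSpace 𝕜 X] [CompleteSpace X] {A : X →ₗ.[𝕜] X} (hA : A.IsClosed)
    (hdense : Dense (A.domain : Set X)) {T : X →L[𝕜] X} {K : ℝ} (hK : 0 ≤ K)
    (hcomm : ∀ x y, (x, y) ∈ A.graph → (T x, T y) ∈ A.graph)
    (hle : ∀ x y, (x, y) ∈ A.graph → ‖T y‖ ≤ K * ‖x‖) :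
    ∃ B : X →L[𝕜] X, (∀ x, (T x, B x) ∈ A.graph) ∧ ‖B‖ ≤ K := by
  have hrange : DenseRange A.domain.subtype := by
    simpa [DenseRange] using hdense
  let TA : A.domain →ₗ[𝕜] X := (T : X →ₗ[𝕜] X) ∘ₗ A.toFun
  have hTA : ∀ x : A.domain, ‖TA x‖ ≤ K * ‖A.domain.subtype x‖ := fun x =>
    hle x (A x) (A.mem_graph x)
  let B : X →L[𝕜] X := TA.extendOfNorm A.domain.subtype
  have hB : ∀ x : A.domain, B x = T (A x) := LinearMap.extendOfNorm_eq hrange ⟨K, hTA⟩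
  refine ⟨B, fun x => ?_, LinearMap.opNorm_extendOfNorm_le hrange hK hTA⟩
  have hclosed : IsClosed {x | (T x, B x) ∈ A.graph} :=
    hA.preimage (T.continuous.prodMk B.continuous)
  refine hdense.induction (P := fun x => (T x, B x) ∈ A.graph) (fun x hx => ?_) hclosed x
  simpa only [hB ⟨x, hx⟩] using hcomm x (A ⟨x, hx⟩) (A.mem_graph ⟨x, hx⟩)

end ClosedOperators

section FractionalConvolution

theorem intervalIntegrable_fracKernel {β : ℝ} (hβ : 0 < β) (a b : ℝ) :
    IntervalIntegrable (fracKernel β) volume a b :=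
  (intervalIntegral.intervalIntegrable_rpow' (by linarith)).div_const _

theorem continuous_fracKernel {β : ℝ} (hβ : 1 ≤ β) : Continuous (fracKernel β) :=
  (Real.continuous_rpow_const (by linarith)).div_const _

theorem integral_fracKernel {β : ℝ} (hβ : 0 < β) (t : ℝ) :
    ∫ s in (0 : ℝ)..t, fracKernel β s = fracKernel (β + 1) t := by
  simp only [fracKernel, intervalIntegral.integral_div]
  rw [integral_rpow (Or.inl (by linarith)), Real.Gamma_add_one hβ.ne', sub_add_cancel,
    add_sub_cancel_right, Real.zero_rpow hβ.ne', sub_zero, div_div]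

theorem mul_fracKernel {β : ℝ} (hβ : 0 < β) {t : ℝ} (ht : 0 ≤ t) :
    t * fracKernel β t = β * fracKernel (β + 1) t := by
  have hrpow : t * t ^ (β - 1) = t ^ β := by
    rw [← Real.rpow_one_add' ht (by linarith), add_sub_cancel]
  simp only [fracKernel, Real.Gamma_add_one hβ.ne', add_sub_cancel_right]
  rw [← mul_div_assoc, hrpow]
  have hΓ := (Real.Gamma_pos_of_pos hβ).ne'
  field_simp

variable {E : Type*} [NormedAddCommGroup E] [NormedSpace ℝ E] {β : ℝ} {f g : ℝ → E}

theorem continuous_fracConv (hβ : 0 < β) (hf : Continuous f) : Continuous (fracConv β f) :=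
  (continuous_integral_kernel_smul (intervalIntegrable_fracKernel hβ)
    (φ := fun t s => f (t - s)) (by fun_prop) continuous_id).congr
      fun t => (integral_kernel_comm (fracKernel β) f t).symm

theorem fracConv_congr {t : ℝ} (ht : 0 ≤ t) (h : ∀ s ∈ Icc 0 t, f s = g s) :
    fracConv β f t = fracConv β g t :=
  intervalIntegral.integral_congr fun s hs => by simp only [h s (uIcc_of_le ht ▸ hs)]

theorem fracConv_const [CompleteSpace E] (hβ : 0 < β) (x : E) (t : ℝ) :
    fracConv β (fun _ => x) t = fracKernel (β + 1) t • x := by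
  rw [fracConv, integral_kernel_comm, intervalIntegral.integral_smul_const,
    integral_fracKernel hβ]

theorem fracConv_add (hβ : 0 < β) (hf : Continuous f) (hg : Continuous g) (t : ℝ) :
    fracConv β (fun s => f s + g s) t = fracConv β f t + fracConv β g t := by
  simp only [fracConv, smul_add]
  exact intervalIntegral.integral_add
    (intervalIntegrable_kernel_smul (intervalIntegrable_fracKernel hβ) hf _ _ _)
    (intervalIntegrable_kernel_smul (intervalIntegrable_fracKernel hβ) hg _ _ _)

theorem fracConv_smul {𝕜 : Type*} [RCLike 𝕜] [NormedSpace 𝕜 E] [SMulCommClass ℝ 𝕜 E] (c : 𝕜)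
    (f : ℝ → E) (t : ℝ) : fracConv β (fun s => c • f s) t = c • fracConv β f t := by
  simp only [fracConv, smul_comm _ c, intervalIntegral.integral_smul]

theorem fracConv_comm {γ : ℝ} (hβ : 0 < β) (hγ : 1 ≤ γ) (hf : Continuous f) {t : ℝ}
    (ht : 0 ≤ t) : fracConv β (fracConv γ f) t = fracConv γ (fracConv β f) t := by
  have hφ : Continuous (Function.uncurry fun v u => fracKernel γ v • f u) :=
    ((continuous_fracKernel hγ).comp continuous_fst).smul (hf.comp continuous_snd)
  refine (integral_kernel_smul_integral_eq_fst (intervalIntegrable_fracKernel hβ) hφ ht).trans ?_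
  simp only [fracConv, integral_kernel_comm (fracKernel γ), smul_comm _ (fracKernel γ _),
    intervalIntegral.integral_smul]

theorem integral_fracConv [CompleteSpace E] (hβ : 0 < β) (hf : Continuous f) {t : ℝ}
    (ht : 0 ≤ t) : ∫ s in (0 : ℝ)..t, fracConv β f s = fracConv (β + 1) f t := by
  have hone : fracKernel 1 = fun _ => 1 := by simp [fracKernel, funext_iff]
  have hcomm := fracConv_comm hβ le_rfl hf ht
  simp only [fracConv, hone, one_smul] at hcomm ⊢
  rw [← hcomm, integral_kernel_smul_integral_eq_snd (φ := fun _ u => f u)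
    (intervalIntegrable_fracKernel hβ) (hf.comp continuous_snd) ht]
  exact intervalIntegral.integral_congr fun u _ => fracConv_const hβ (f u) (t - u)

theorem smul_fracConv (hβ : 0 < β) (hf : Continuous f) {t : ℝ} (ht : 0 ≤ t) :
    t • fracConv β f t = β • fracConv (β + 1) f t + fracConv β (fun s => s • f s) t := by
  have hint_const : IntervalIntegrable (fun s => fracKernel (β + 1) (t - s) • β • f s) volume 0 t :=
    intervalIntegrable_kernel_smul (intervalIntegrable_fracKernel (by linarith))
      (hf.const_smul β) _ _ _
  have hint_id : IntervalIntegrable (fun s => fracKernel β (t - s) • s • f s) volume 0 t :=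
    intervalIntegrable_kernel_smul (intervalIntegrable_fracKernel hβ) (continuous_id.smul hf) _ _ _
  rw [← fracConv_smul, ← fracConv_smul]
  simp only [fracConv]
  rw [← intervalIntegral.integral_add hint_const hint_id]
  refine intervalIntegral.integral_congr fun s hs => ?_
  rw [uIcc_of_le ht] at hs
  simp only [smul_smul, ← add_smul]
  congr 1
  linear_combination mul_fracKernel hβ (sub_nonneg.2 hs.2)

end FractionalConvolution

section Resolvent

variable {𝕜 X : Type*} [RCLike 𝕜] [NormedAddCommGroup X] [NormedSpace 𝕜 X] [NormedSpace ℝ X]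
  {α : ℝ} {A : X →ₗ.[𝕜] X} {S : ℝ → X →L[𝕜] X}

theorem resolventP_zero (α : ℝ) (S : ℝ → X →L[𝕜] X) (x : X) : resolventP α S 0 x = 0 :=
  intervalIntegral.integral_same

section Continuity

variable [CompleteSpace X]

theorem continuous_resolventP (hα : 1 < α) (hSc : ∀ x, Continuous fun t => S t x) :
    Continuous fun p : ℝ × X => resolventP α S p.1 p.2 := by
  have hφ : Continuous (Function.uncurry fun (p : ℝ × X) s => S (p.1 - s) p.2) :=
    (continuous_uncurry_of_strongly_continuous hSc).comp
      (f := fun q : (ℝ × X) × ℝ => (q.1.1 - q.2, q.1.2)) (by fun_prop)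
  exact (continuous_integral_kernel_smul (intervalIntegrable_fracKernel (sub_pos.2 hα)) hφ
    continuous_fst).congr fun p => (integral_kernel_comm _ (fun s => S s p.2) p.1).symm

theorem continuous_smul_resolventP_sub (hα : 1 < α) (hSc : ∀ x, Continuous fun t => S t x) (t : ℝ)
    {f : ℝ → X} (hf : Continuous f) :
    Continuous fun s => (t - s) • resolventP α S (t - s) (f s) :=
  (continuous_sub_left t).smul ((continuous_resolventP hα hSc).comp₂ (continuous_sub_left t) hf)

variable [IsScalarTower ℝ 𝕜 X]

/-- The operator `P_α(t)` as a bounded operator, for an everywhere strongly continuous family. -/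
noncomputable def resolventPL (hα : 1 < α) (hSc : ∀ x, Continuous fun t => S t x) (t : ℝ) :
    X →L[𝕜] X where
  toFun := resolventP α S t
  map_add' x y := by
    simp only [resolventP, map_add]
    exact fracConv_add (sub_pos.2 hα) (hSc x) (hSc y) t
  map_smul' c x := by
    simp only [resolventP, map_smul, RingHom.id_apply]
    exact fracConv_smul c _ t
  cont := (continuous_resolventP hα hSc).comp (Continuous.prodMk_right t)

theorem resolventP_integral_kernel_smul (hα : 1 < α) (hSc : ∀ x, Continuous fun t => S t x)
    (t : ℝ) {k : ℝ → ℝ} (hk : ∀ a b, IntervalIntegrable k volume a b) {f : ℝ → X}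
    (hf : Continuous f) (s : ℝ) :
    resolventP α S t (∫ u in (0 : ℝ)..s, k (s - u) • f u) =
      ∫ u in (0 : ℝ)..s, k (s - u) • resolventP α S t (f u) := by
  change resolventPL hα hSc t _ = ∫ u in (0 : ℝ)..s, k (s - u) • resolventPL hα hSc t (f u)
  rw [← ContinuousLinearMap.intervalIntegral_comp_comm _
    (intervalIntegrable_kernel_smul hk hf s 0 s)]
  simp only [ContinuousLinearMap.map_smul_of_tower]

theorem integral_smul_resolventP_fracConv (hα : 1 < α) (hSc : ∀ x, Continuous fun t => S t x)
    {β : ℝ} (hβ : 0 < β) {f : ℝ → X} (hf : Continuous f) {t : ℝ} (ht : 0 ≤ t) :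
    ∫ s in (0 : ℝ)..t, (t - s) • resolventP α S (t - s) (fracConv β f s) =
      ∫ u in (0 : ℝ)..t, fracConv β (fun v => v • resolventP α S v (f u)) (t - u) := by
  have hk := intervalIntegrable_fracKernel hβ
  have hφ : Continuous (Function.uncurry fun v u => v • resolventP α S v (f u)) :=
    continuous_fst.smul ((continuous_resolventP hα hSc).comp
      (f := fun p : ℝ × ℝ => (p.1, f p.2)) (by fun_prop))
  calc ∫ s in (0 : ℝ)..t, (t - s) • resolventP α S (t - s) (fracConv β f s)
      = ∫ v in (0 : ℝ)..t, v • resolventP α S v (fracConv β f (t - v)) := by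
        simpa using intervalIntegral.integral_comp_sub_left (a := 0) (b := t)
          (fun v => v • resolventP α S v (fracConv β f (t - v))) t
    _ = ∫ v in (0 : ℝ)..t, ∫ u in (0 : ℝ)..(t - v),
          fracKernel β (t - v - u) • v • resolventP α S v (f u) := by
        refine intervalIntegral.integral_congr fun v _ => ?_
        simp only [fracConv, resolventP_integral_kernel_smul hα hSc _ hk hf, smul_comm _ v,
          intervalIntegral.integral_smul]
    _ = ∫ u in (0 : ℝ)..t, fracConv β (fun v => v • resolventP α S v (f u)) (t - u) :=
        (integral_kernel_smul_integral_eq_fst hk hφ ht).symm.trans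
          (integral_kernel_smul_integral_eq_snd hk hφ ht)

end Continuity

namespace IsResolventFamily

variable (hS : IsResolventFamily α A S)
include hS

theorem comp_max : IsResolventFamily α A fun t => S (max t 0) where
  isClosed := hS.isClosed
  dense_domain := hS.dense_domain
  strongly_continuous x := (hS.strongly_continuous x).congr fun t ht => by
    simp only [max_eq_left (mem_Ici.1 ht)]
  map_zero := by simp only [max_self, hS.map_zero]
  commute t _ x := hS.commute (max t 0) (le_max_right _ _) x
  resolvent_eq x t ht := by
    have hconv : fracConv α (fun s => S (max s 0) (A x)) t = fracConv α (fun s => S s (A x)) t :=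
      fracConv_congr ht fun s hs => by simp only [max_eq_left hs.1]
    rw [hconv, max_eq_left ht, hS.resolvent_eq x t ht]

theorem mem_graph {x y : X} (hxy : (x, y) ∈ A.graph) {t : ℝ} (ht : 0 ≤ t) :
    (S t x, S t y) ∈ A.graph := by
  obtain ⟨z, rfl, rfl⟩ := A.mem_graph_iff.1 hxy
  obtain ⟨h, hcomm⟩ := hS.commute t ht z
  exact hcomm ▸ A.mem_graph ⟨_, h⟩

theorem eq_add_fracConv {x y : X} (hxy : (x, y) ∈ A.graph) {t : ℝ} (ht : 0 ≤ t) :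
    S t x = x + fracConv α (fun s => S s y) t := by
  obtain ⟨z, rfl, rfl⟩ := A.mem_graph_iff.1 hxy
  exact hS.resolvent_eq z t ht

variable (hSc : ∀ x, Continuous fun t => S t x) [CompleteSpace X]
include hSc

theorem resolventP_mem_graph [IsScalarTower ℝ 𝕜 X] (hα : 1 < α) {x y : X}
    (hxy : (x, y) ∈ A.graph) {t : ℝ} (ht : 0 ≤ t) :
    (resolventP α S t x, resolventP α S t y) ∈ A.graph := by
  have hint : ∀ z, IntervalIntegrable (fun s => fracKernel (α - 1) (t - s) • S s z) volume 0 t :=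
    fun z => intervalIntegrable_kernel_smul (intervalIntegrable_fracKernel (sub_pos.2 hα))
      (hSc z) _ _ _
  refine intervalIntegral_mem_graph_of_isClosed hS.isClosed ht (hint x) (hint y) fun s hs => ?_
  exact (A.graph.restrictScalars ℝ).smul_mem (fracKernel (α - 1) (t - s)) (hS.mem_graph hxy hs.1)

theorem sub_eq_integral_resolventP (hα : 1 < α) {x y : X} (hxy : (x, y) ∈ A.graph) {c d : ℝ}
    (hc : 0 ≤ c) (hd : 0 ≤ d) : S d x - S c x = ∫ s in c..d, resolventP α S s y := by
  have hprim : ∀ t, 0 ≤ t → S t x = x + ∫ s in (0 : ℝ)..t, resolventP α S s y := fun t ht => by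
    have hint := integral_fracConv (sub_pos.2 hα) (hSc y) ht
    rw [sub_add_cancel] at hint
    exact (hS.eq_add_fracConv hxy ht).trans (congrArg (x + ·) hint.symm)
  have hcont : Continuous fun s => resolventP α S s y :=
    continuous_fracConv (sub_pos.2 hα) (hSc y)
  rw [hprim d hd, hprim c hc, add_sub_add_left_eq_sub]
  exact intervalIntegral.integral_interval_sub_left (hcont.intervalIntegrable _ _)
    (hcont.intervalIntegrable _ _)

theorem resolventP_eq (hα : 1 < α) {x y : X} (hxy : (x, y) ∈ A.graph) {t : ℝ} (ht : 0 ≤ t) :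
    resolventP α S t x = fracKernel α t • x + fracConv α (fun s => resolventP α S s y) t := by
  have hα' : 0 < α - 1 := sub_pos.2 hα
  calc resolventP α S t x
      = fracConv (α - 1) (fun s => x + fracConv α (fun u => S u y) s) t :=
        fracConv_congr ht fun s hs => hS.eq_add_fracConv hxy hs.1
    _ = fracConv (α - 1) (fun _ => x) t + fracConv (α - 1) (fracConv α fun u => S u y) t :=
        fracConv_add hα' continuous_const (continuous_fracConv (by linarith) (hSc y)) t
    _ = fracKernel α t • x + fracConv α (fun s => resolventP α S s y) t := by
        rw [fracConv_const hα', sub_add_cancel, fracConv_comm hα' hα.le (hSc y) ht]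
        rfl

theorem smul_resolventP_eq (hα : 1 < α) {x y : X} (hxy : (x, y) ∈ A.graph) {t : ℝ}
    (ht : 0 ≤ t) :
    t • resolventP α S t x = α • (∫ s in (0 : ℝ)..t, resolventP α S s x) +
      fracConv α (fun s => s • resolventP α S s y) t := by
  have hα' : 0 < α := by linarith
  have hPc : Continuous fun s => resolventP α S s y :=
    continuous_fracConv (sub_pos.2 hα) (hSc y)
  have hgc : Continuous fun s => fracKernel α s • x :=
    (continuous_fracKernel hα.le).smul continuous_const
  have hint : ∫ s in (0 : ℝ)..t, resolventP α S s x =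
      fracKernel (α + 1) t • x + fracConv (α + 1) (fun s => resolventP α S s y) t := by
    rw [← integral_fracConv hα' hPc ht, ← integral_fracKernel hα',
      ← intervalIntegral.integral_smul_const, ← intervalIntegral.integral_add
        (hgc.intervalIntegrable _ _) ((continuous_fracConv hα' hPc).intervalIntegrable _ _)]
    exact intervalIntegral.integral_congr fun s hs =>
      hS.resolventP_eq hSc hα hxy (uIcc_of_le ht ▸ hs).1
  rw [hint, hS.resolventP_eq hSc hα hxy ht, smul_add, smul_fracConv hα' hPc ht, smul_smul,
    mul_fracKernel hα' ht, smul_add, smul_smul, add_assoc]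

theorem integral_smul_resolventP_apply_eq_smul_integral_add (hα : 1 < α) {x y : X}
    (hxy : (x, y) ∈ A.graph) {t : ℝ} (ht : 0 ≤ t) :
    ∫ s in (0 : ℝ)..t, (t - s) • resolventP α S (t - s) (S s x) =
      (∫ s in (0 : ℝ)..t, α • ∫ u in (0 : ℝ)..s, resolventP α S (s - u) (S u x)) +
        ∫ u in (0 : ℝ)..t, fracConv α (fun v => v • resolventP α S v (S u y)) (t - u) := by
  have hPS : Continuous (Function.uncurry fun v u => resolventP α S v (S u x)) :=
    (continuous_resolventP hα hSc).comp₂ continuous_fst ((hSc x).comp continuous_snd)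
  have hcont : Continuous fun u => α • ∫ v in (0 : ℝ)..(t - u), resolventP α S v (S u x) :=
    (intervalIntegral.continuous_parametric_intervalIntegral_of_continuous
      (f := fun u v => resolventP α S v (S u x)) (hPS.comp continuous_swap)
      (continuous_sub_left t)).const_smul α
  have hswap := integral_kernel_smul_integral_eq_snd (k := fun _ => 1)
    (fun _ _ => intervalIntegrable_const) hPS ht
  simp only [one_smul] at hswap
  rw [intervalIntegral.integral_smul, hswap, ← intervalIntegral.integral_smul,
    ← sub_eq_iff_eq_add', ← intervalIntegral.integral_sub
      ((continuous_smul_resolventP_sub hα hSc t (hSc x)).intervalIntegrable _ _)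
      (hcont.intervalIntegrable _ _)]
  refine intervalIntegral.integral_congr fun u hu => ?_
  obtain ⟨hu0, hut⟩ := uIcc_of_le ht ▸ hu
  exact sub_eq_of_eq_add' (hS.smul_resolventP_eq hSc hα (hS.mem_graph hxy hu0)
    (sub_nonneg.2 hut))

variable [IsScalarTower ℝ 𝕜 X]

theorem integral_smul_resolventP_apply_eq_integral_add (hα : 1 < α) {x y : X}
    (hxy : (x, y) ∈ A.graph) {t : ℝ} (ht : 0 ≤ t) :
    ∫ s in (0 : ℝ)..t, (t - s) • resolventP α S (t - s) (S s x) =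
      (∫ s in (0 : ℝ)..t, (t - s) • resolventP α S (t - s) x) +
        ∫ u in (0 : ℝ)..t, fracConv α (fun v => v • resolventP α S v (S u y)) (t - u) := by
  have hα' : 0 < α := by linarith
  rw [← integral_smul_resolventP_fracConv hα hSc hα' (hSc y) ht,
    ← intervalIntegral.integral_add
      ((continuous_smul_resolventP_sub hα hSc t continuous_const).intervalIntegrable _ _)
      ((continuous_smul_resolventP_sub hα hSc t
        (continuous_fracConv hα' (hSc y))).intervalIntegrable _ _)]
  refine intervalIntegral.integral_congr fun s hs => ?_
  simp only [hS.eq_add_fracConv hxy (uIcc_of_le ht ▸ hs).1, ← smul_add]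
  exact congrArg _ ((resolventPL hα hSc (t - s)).map_add _ _)

theorem integral_smul_resolventP_eq (hα : 1 < α) {x y : X} (hxy : (x, y) ∈ A.graph) {t : ℝ}
    (ht : 0 ≤ t) :
    ∫ s in (0 : ℝ)..t, s • resolventP α S s x =
      ∫ s in (0 : ℝ)..t, α • ∫ u in (0 : ℝ)..s, resolventP α S (s - u) (S u x) := by
  have hreflect := intervalIntegral.integral_comp_sub_left (a := 0) (b := t)
    (fun s => s • resolventP α S s x) t
  rw [sub_self, sub_zero] at hreflect
  rw [← hreflect]
  exact add_right_cancel <|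
    (hS.integral_smul_resolventP_apply_eq_integral_add hSc hα hxy ht).symm.trans
      (hS.integral_smul_resolventP_apply_eq_smul_integral_add hSc hα hxy ht)

theorem smul_resolventP_eq_conv (hα : 1 < α) (x : X) {t : ℝ} (ht : 0 ≤ t) :
    t • resolventP α S t x = α • ∫ s in (0 : ℝ)..t, resolventP α S (t - s) (S s x) := by
  have hconv : Continuous fun p : ℝ × X =>
      ∫ s in (0 : ℝ)..p.1, resolventP α S (p.1 - s) (S s p.2) :=
    intervalIntegral.continuous_parametric_intervalIntegral_of_continuous
      (f := fun (p : ℝ × X) s => resolventP α S (p.1 - s) (S s p.2))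
      ((continuous_resolventP hα hSc).comp₂ (by fun_prop)
        ((continuous_uncurry_of_strongly_continuous hSc).comp₂ (by fun_prop) (by fun_prop)))
      continuous_fst
  refine congrFun (Continuous.ext_on hS.dense_domain
    ((resolventPL hα hSc t).continuous.const_smul t)
    ((hconv.comp (Continuous.prodMk_right t)).const_smul α) fun z hz => ?_) x
  exact eq_of_forall_integral_eq
    (continuous_id.smul ((continuous_resolventP hα hSc).comp (Continuous.prodMk_left z)))
    ((hconv.comp (Continuous.prodMk_left z)).const_smul α)
    (fun _ => hS.integral_smul_resolventP_eq hSc hα (A.mem_graph ⟨z, hz⟩)) ht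

end IsResolventFamily

end Resolvent

namespace Subdivision

variable {a b : ℝ} (d : Subdivision a b)

theorem pt_le_pt {i j : ℕ} (hij : i ≤ j) (hj : j ≤ d.n) : d.pt i ≤ d.pt j := by
  induction j, hij using Nat.le_induction with
  | base => exact le_rfl
  | succ j _ ih => exact (ih (Nat.le_of_succ_le hj)).trans (d.pt_lt j hj).le

theorem pt_mem_Icc {i : ℕ} (hi : i ≤ d.n) : d.pt i ∈ Icc a b :=
  ⟨d.pt_zero.ge.trans (d.pt_le_pt (Nat.zero_le i) hi), (d.pt_le_pt hi le_rfl).trans d.pt_last.le⟩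

/-- The subdivision of `[a, c]` obtained from one of `[a, b]` by adding the interval `[b, c]`. -/
noncomputable def snoc {c : ℝ} (hbc : b < c) : Subdivision a c where
  n := d.n + 1
  pt i := if i ≤ d.n then d.pt i else c
  pt_zero := by simp [d.pt_zero]
  pt_last := by simp
  pt_lt i hi := by
    rcases (Nat.lt_succ_iff.1 hi).eq_or_lt with rfl | hi
    · simpa [d.pt_last] using hbc
    · simpa [hi.le, Nat.succ_le_of_lt hi] using d.pt_lt i hi

/-- The subdivision of `[a, b]` into `n + 1` intervals of equal length. -/
noncomputable def uniform (hab : a < b) (n : ℕ) : Subdivision a b where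
  n := n + 1
  pt i := a + i * ((b - a) / (n + 1))
  pt_zero := by simp
  pt_last := by push_cast; field_simp; ring
  pt_lt i _ := by
    have hstep : 0 < (b - a) / (n + 1) := div_pos (sub_pos.2 hab) (by positivity)
    push_cast
    linarith

theorem exists_mesh_le (hab : a ≤ b) {δ : ℝ} (hδ : 0 < δ) :
    ∃ d : Subdivision a b, ∀ i < d.n, d.pt (i + 1) - d.pt i ≤ δ := by
  rcases hab.eq_or_lt with rfl | hab
  · exact ⟨⟨0, fun _ => a, rfl, rfl, fun _ hi => absurd hi (Nat.not_lt_zero _)⟩,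
      fun _ _ => by simpa using hδ.le⟩
  · obtain ⟨n, hn⟩ := exists_nat_gt ((b - a) / δ)
    refine ⟨uniform hab n, fun i _ => ?_⟩
    have hstep : (b - a) / (n + 1) ≤ δ := by
      rw [div_lt_iff₀ hδ] at hn
      rw [div_le_iff₀ (by positivity)]
      linarith
    simp only [uniform]
    push_cast
    linarith

end Subdivision

section Semivariation

variable {𝕜 X : Type*} [RCLike 𝕜] [NormedAddCommGroup X] [NormedSpace 𝕜 X]
  {G : ℝ → X →L[𝕜] X} {a b : ℝ}

theorem enorm_sum_apply_le_semivariation (G : ℝ → X →L[𝕜] X) (d : Subdivision a b) {x : ℕ → X}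
    (hx : ∀ i < d.n, ‖x i‖ ≤ 1) :
    ‖∑ i ∈ Finset.range d.n, (G (d.pt (i + 1)) - G (d.pt i)) (x i)‖ₑ ≤ semivariation G a b := by
  let y : ℕ → X := fun i => if i < d.n then x i else 0
  have hy : ∀ i, ‖y i‖ ≤ 1 := fun i => by
    by_cases hi : i < d.n <;> simp [y, hi, hx]
  calc ‖∑ i ∈ Finset.range d.n, (G (d.pt (i + 1)) - G (d.pt i)) (x i)‖ₑ
      = ‖∑ i ∈ Finset.range d.n, (G (d.pt (i + 1)) - G (d.pt i)) (y i)‖ₑ := by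
        congr 1
        exact Finset.sum_congr rfl fun i hi => by
          simp only [y, if_pos (Finset.mem_range.1 hi)]
    _ ≤ semivariationOn G d := le_iSup₂_of_le y hy le_rfl
    _ ≤ semivariation G a b := le_iSup (semivariationOn G) d

theorem HasBoundedSemivariation.norm_sum_apply_le (hG : HasBoundedSemivariation G a b)
    (d : Subdivision a b) {x : ℕ → X} {M : ℝ} (hM : 0 ≤ M) (hx : ∀ i < d.n, ‖x i‖ ≤ M) :
    ‖∑ i ∈ Finset.range d.n, (G (d.pt (i + 1)) - G (d.pt i)) (x i)‖ ≤
      (semivariation G a b).toReal * M := by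
  rcases hM.eq_or_lt with rfl | hM
  · rw [Finset.sum_eq_zero fun i hi => by
      rw [norm_le_zero_iff.1 (hx i (Finset.mem_range.1 hi)), map_zero]]
    simp
  have hunit := enorm_sum_apply_le_semivariation G d (x := fun i => ((M⁻¹ : ℝ) : 𝕜) • x i)
    fun i hi => by
      rw [norm_smul, RCLike.norm_ofReal, abs_of_pos (inv_pos.2 hM), inv_mul_le_iff₀ hM, mul_one]
      exact hx i hi
  have hreal := ENNReal.toReal_mono hG.ne hunit
  simp only [map_smul, ← Finset.smul_sum, toReal_enorm, norm_smul, RCLike.norm_ofReal,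
    abs_of_pos (inv_pos.2 hM)] at hreal
  rwa [inv_mul_le_iff₀ hM, mul_comm] at hreal

theorem semivariation_mono_right {c : ℝ} (hbc : b ≤ c) :
    semivariation G a b ≤ semivariation G a c := by
  rcases hbc.eq_or_lt with rfl | hbc
  · exact le_rfl
  refine iSup_le fun d => iSup₂_le fun x hx => ?_
  let y : ℕ → X := fun i => if i < d.n then x i else 0
  have hy : ∀ i, ‖y i‖ ≤ 1 := fun i => by
    by_cases hi : i < d.n <;> simp [y, hi, hx]
  refine le_of_eq_of_le ?_ (enorm_sum_apply_le_semivariation G (d.snoc hbc) fun i _ => hy i)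
  change _ = ‖∑ i ∈ Finset.range (d.n + 1), _‖ₑ
  rw [Finset.sum_range_succ, show y d.n = 0 from if_neg (lt_irrefl _), map_zero, add_zero]
  congr 1
  refine Finset.sum_congr rfl fun i hi => ?_
  have hi := Finset.mem_range.1 hi
  simp only [Subdivision.snoc, y, if_pos hi, if_pos hi.le, if_pos (Nat.succ_le_of_lt hi)]

theorem semivariation_comp_max (S : ℝ → X →L[𝕜] X) (r : ℝ) :
    semivariation (fun t => S (max t 0)) 0 r = semivariation S 0 r := by
  refine iSup_congr fun d => iSup_congr fun x => iSup_congr fun _ => ?_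
  congr 1
  refine Finset.sum_congr rfl fun i hi => ?_
  have hi := Finset.mem_range.1 hi
  simp only [max_eq_left (d.pt_mem_Icc hi.le).1,
    max_eq_left (d.pt_mem_Icc (Nat.succ_le_of_lt hi)).1]

theorem norm_sum_integral_sub_integral_diagonal_le {E : Type*} [NormedAddCommGroup E]
    [NormedSpace ℝ E] {Φ : ℝ → ℝ → E} (hΦ : Continuous (Function.uncurry Φ)) (d : Subdivision a b)
    {η : ℝ} (hη : ∀ i < d.n, ∀ u ∈ Icc (d.pt i) (d.pt (i + 1)), ‖Φ u (d.pt i) - Φ u u‖ ≤ η) :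
    ‖(∑ i ∈ Finset.range d.n, ∫ u in (d.pt i)..(d.pt (i + 1)), Φ u (d.pt i)) -
      ∫ u in a..b, Φ u u‖ ≤ η * (b - a) := by
  have hcol : ∀ v, Continuous fun u => Φ u v := fun v => hΦ.comp (Continuous.prodMk_left v)
  have hdiag : Continuous fun u => Φ u u := hΦ.comp (continuous_id.prodMk continuous_id)
  have hsplit := intervalIntegral.sum_integral_adjacent_intervals (μ := volume)
    (f := fun u => Φ u u) (a := d.pt) (n := d.n) fun _ _ => hdiag.intervalIntegrable _ _
  rw [d.pt_zero, d.pt_last] at hsplit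
  have hlength := Finset.sum_range_sub d.pt d.n
  rw [d.pt_zero, d.pt_last] at hlength
  rw [← hsplit, ← hlength, ← Finset.sum_sub_distrib, Finset.mul_sum]
  refine norm_sum_le_of_le _ fun i hi => ?_
  have hi := Finset.mem_range.1 hi
  have hle := (d.pt_lt i hi).le
  rw [← intervalIntegral.integral_sub ((hcol _).intervalIntegrable _ _)
    (hdiag.intervalIntegrable _ _), ← abs_of_nonneg (sub_nonneg.2 hle)]
  refine intervalIntegral.norm_integral_le_of_norm_le_const fun u hu => hη i hi u ?_
  exact Ioc_subset_Icc_self (uIoc_of_le hle ▸ hu)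

theorem exists_norm_sum_integral_sub_integral_diagonal_le {E : Type*} [NormedAddCommGroup E]
    [NormedSpace ℝ E] {Φ : ℝ → ℝ → E} (hΦ : Continuous (Function.uncurry Φ)) (hab : a ≤ b)
    {η : ℝ} (hη : 0 < η) :
    ∃ d : Subdivision a b,
      ‖(∑ i ∈ Finset.range d.n, ∫ u in (d.pt i)..(d.pt (i + 1)), Φ u (d.pt i)) -
        ∫ u in a..b, Φ u u‖ ≤ η * (b - a) := by
  have hunif := (isCompact_Icc.prod isCompact_Icc).uniformContinuousOn_of_continuous
    (hΦ.continuousOn (s := Icc a b ×ˢ Icc a b))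
  rw [Metric.uniformContinuousOn_iff_le] at hunif
  obtain ⟨δ, hδ, hΦδ⟩ := hunif η hη
  obtain ⟨d, hmesh⟩ := Subdivision.exists_mesh_le hab hδ
  refine ⟨d, norm_sum_integral_sub_integral_diagonal_le hΦ d fun i hi u hu => ?_⟩
  have hpt := d.pt_mem_Icc hi.le
  have hu' : u ∈ Icc a b := ⟨hpt.1.trans hu.1, hu.2.trans (d.pt_mem_Icc hi).2⟩
  rw [← dist_eq_norm]
  refine hΦδ (u, d.pt i) ⟨hu', hpt⟩ (u, u) ⟨hu', hu'⟩ ?_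
  rw [Prod.dist_eq, dist_self, max_eq_right dist_nonneg, dist_comm, Real.dist_eq,
    abs_of_nonneg (sub_nonneg.2 hu.1)]
  linarith [hmesh i hi, hu.2]

theorem HasBoundedSemivariation.norm_integral_diagonal_le [NormedSpace ℝ X]
    (hG : HasBoundedSemivariation G a b) (hab : a ≤ b) {Φ : ℝ → ℝ → X}
    (hΦ : Continuous (Function.uncurry Φ)) {g : ℝ → X} {M : ℝ} (hM : ∀ v ∈ Icc a b, ‖g v‖ ≤ M)
    (h : ∀ v ∈ Icc a b, ∀ c ∈ Icc a b, ∀ d ∈ Icc a b,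
      G d (g v) - G c (g v) = ∫ u in c..d, Φ u v) :
    ‖∫ u in a..b, Φ u u‖ ≤ (semivariation G a b).toReal * M := by
  have hM0 : 0 ≤ M := (norm_nonneg _).trans (hM a (left_mem_Icc.2 hab))
  have happrox : ∀ η > 0,
      ‖∫ u in a..b, Φ u u‖ ≤ (semivariation G a b).toReal * M + η * (b - a) := by
    intro η hη
    obtain ⟨d, hdist⟩ := exists_norm_sum_integral_sub_integral_diagonal_le hΦ hab hη
    have hsum : ∑ i ∈ Finset.range d.n, ∫ u in (d.pt i)..(d.pt (i + 1)), Φ u (d.pt i) =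
        ∑ i ∈ Finset.range d.n, (G (d.pt (i + 1)) - G (d.pt i)) (g (d.pt i)) :=
      Finset.sum_congr rfl fun i hi => by
        have hi := Finset.mem_range.1 hi
        exact (h _ (d.pt_mem_Icc hi.le) _ (d.pt_mem_Icc hi.le) _ (d.pt_mem_Icc hi)).symm
    rw [hsum] at hdist
    exact (norm_le_norm_add_norm_sub _ _).trans
      (add_le_add (hG.norm_sum_apply_le d hM0 fun i hi => hM _ (d.pt_mem_Icc hi.le)) hdist)
  have hlim : Tendsto (fun η => (semivariation G a b).toReal * M + η * (b - a)) (𝓝[>] 0)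
      (𝓝 ((semivariation G a b).toReal * M)) :=
    tendsto_nhdsWithin_of_tendsto_nhds (Continuous.tendsto' (by fun_prop) _ _ (by simp))
  exact ge_of_tendsto hlim (eventually_mem_nhdsWithin.mono happrox)

end Semivariation

section Estimate

variable {𝕜 X : Type*} [RCLike 𝕜] [NormedAddCommGroup X] [NormedSpace 𝕜 X] [NormedSpace ℝ X]
  [IsScalarTower ℝ 𝕜 X] [CompleteSpace X] {α : ℝ} {A : X →ₗ.[𝕜] X} {S : ℝ → X →L[𝕜] X} {r M : ℝ}

namespace IsResolventFamily

theorem mul_norm_resolventP_le (hS : IsResolventFamily α A S)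
    (hSc : ∀ x, Continuous fun t => S t x) (hα : 1 < α) (hSV : HasBoundedSemivariation S 0 r)
    (hM : ∀ t ∈ Icc 0 r, ‖S t‖ ≤ M) {t : ℝ} (ht : t ∈ Icc 0 r) {x y : X}
    (hxy : (x, y) ∈ A.graph) :
    t * ‖resolventP α S t y‖ ≤ α * ((semivariation S 0 r).toReal * M) * ‖x‖ := by
  have hSVt : semivariation S 0 t ≤ semivariation S 0 r := semivariation_mono_right ht.2
  have hM0 : 0 ≤ M := (norm_nonneg _).trans (hM t ht)
  have hSM : ∀ v ∈ Icc 0 t, ‖S (t - v) x‖ ≤ M * ‖x‖ := fun v hv =>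
    (S (t - v)).le_of_opNorm_le
      (hM _ ⟨sub_nonneg.2 hv.2, (sub_le_self t hv.1).trans ht.2⟩) x
  have hΦ : Continuous (Function.uncurry fun u v => resolventP α S u (S (t - v) y)) :=
    (continuous_resolventP hα hSc).comp₂ continuous_fst
      ((hSc y).comp ((continuous_sub_left t).comp continuous_snd))
  have hdiag : ‖∫ u in (0 : ℝ)..t, resolventP α S u (S (t - u) y)‖ ≤
      (semivariation S 0 t).toReal * (M * ‖x‖) :=
    HasBoundedSemivariation.norm_integral_diagonal_le (hSVt.trans_lt hSV) ht.1 hΦ hSM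
      fun v hv _ hc _ hd => hS.sub_eq_integral_resolventP hSc hα
        (hS.mem_graph hxy (sub_nonneg.2 hv.2)) hc.1 hd.1
  have hreflect := integral_kernel_comm (fun _ => 1) (fun s => resolventP α S (t - s) (S s y)) t
  simp only [one_smul, sub_sub_cancel] at hreflect
  calc t * ‖resolventP α S t y‖
      = ‖t • resolventP α S t y‖ := by rw [norm_smul, Real.norm_of_nonneg ht.1]
    _ = α * ‖∫ u in (0 : ℝ)..t, resolventP α S u (S (t - u) y)‖ := by
        rw [hS.smul_resolventP_eq_conv hSc hα y ht.1, hreflect, norm_smul,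
          Real.norm_of_nonneg (by linarith)]
    _ ≤ α * ((semivariation S 0 t).toReal * (M * ‖x‖)) := by gcongr
    _ ≤ α * ((semivariation S 0 r).toReal * (M * ‖x‖)) := by
        have := ENNReal.toReal_mono hSV.ne hSVt
        gcongr
    _ = α * ((semivariation S 0 r).toReal * M) * ‖x‖ := by ring

theorem exists_clm_comp_resolventP (hS : IsResolventFamily α A S)
    (hSc : ∀ x, Continuous fun t => S t x) (hα : 1 < α) (hSV : HasBoundedSemivariation S 0 r) :
    ∃ K : ℝ, ∀ t ∈ Icc 0 r, ∃ B : X →L[𝕜] X,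
      (∀ x, (resolventP α S t x, B x) ∈ A.graph) ∧ ‖(t : 𝕜) • B‖ ≤ K := by
  obtain ⟨M, hM⟩ := exists_norm_le_of_strongly_continuous hSc 0 r
  let K := α * ((semivariation S 0 r).toReal * M)
  refine ⟨K, fun t ht => ?_⟩
  have hM0 : 0 ≤ M := (norm_nonneg _).trans (hM t ht)
  have hK : 0 ≤ K := by positivity
  rcases ht.1.eq_or_lt with rfl | ht0
  · refine ⟨0, fun x => ?_, by rwa [smul_zero, norm_zero]⟩
    rw [resolventP_zero]
    exact A.graph.zero_mem
  obtain ⟨B, hB, hBle⟩ := exists_clm_comp_of_commute_of_le hS.isClosed hS.dense_domain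
    (T := resolventPL hα hSc t) (div_nonneg hK ht0.le)
    (fun _ _ hxy => hS.resolventP_mem_graph hSc hα hxy ht0.le) fun x y hxy => by
      rw [div_mul_eq_mul_div, le_div_iff₀' ht0]
      exact hS.mul_norm_resolventP_le hSc hα hSV hM ht hxy
  refine ⟨B, hB, ?_⟩
  rw [norm_smul, RCLike.norm_ofReal, abs_of_pos ht0]
  exact (le_div_iff₀' ht0).1 hBle

end IsResolventFamily

end Estimate

end FractionalResolvent

open FractionalResolvent in
theorem mainTheorem3_general {𝕜 X : Type*} [RCLike 𝕜] [NormedAddCommGroup X] [NormedSpace 𝕜 X]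
    [NormedSpace ℝ X] [IsScalarTower ℝ 𝕜 X] [CompleteSpace X] {α : ℝ} (hα : 1 < α)
    {A : X →ₗ.[𝕜] X} {S : ℝ → X →L[𝕜] X} (hS : IsResolventFamily α A S) {r : ℝ}
    (hSV : HasBoundedSemivariation S 0 r) :
    (∀ t ∈ Icc 0 r, range (resolventP α S t) ⊆ (A.domain : Set X)) ∧
    ∃ AP : ℝ → X →L[𝕜] X,
      (∀ t ∈ Icc 0 r, ∀ x : X,
        ∃ h : resolventP α S t x ∈ A.domain, A ⟨resolventP α S t x, h⟩ = AP t x) ∧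
      BddAbove ((fun t : ℝ => ‖(t : 𝕜) • AP t‖) '' Icc 0 r) := by
  have hSc : ∀ x, Continuous fun t => S (max t 0) x := fun x =>
    (hS.strongly_continuous x).comp_continuous (by fun_prop) fun t => le_max_right t 0
  have hSV_max : HasBoundedSemivariation (fun t => S (max t 0)) 0 r :=
    (semivariation_comp_max S r).trans_lt hSV
  obtain ⟨K, hK⟩ := hS.comp_max.exists_clm_comp_resolventP hSc hα hSV_max
  choose! AP hAP hle using hK
  have hgraph : ∀ t ∈ Icc 0 r, ∀ x, (resolventP α S t x, AP t x) ∈ A.graph := fun t ht x => by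
    have hP : resolventP α (fun t => S (max t 0)) t x = resolventP α S t x :=
      fracConv_congr ht.1 fun s hs => by simp only [max_eq_left hs.1]
    exact hP ▸ hAP t ht x
  have hdom : ∀ t ∈ Icc 0 r, ∀ x, resolventP α S t x ∈ A.domain := fun t ht x =>
    LinearPMap.mem_domain_of_mem_graph (hgraph t ht x)
  refine ⟨fun t ht => range_subset_iff.2 (hdom t ht), AP, fun t ht x => ⟨hdom t ht x, ?_⟩, K, ?_⟩
  · exact LinearPMap.mem_graph_snd_inj A (A.mem_graph _) (hgraph t ht x) rfl
  · exact forall_mem_image.2 hle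

theorem mainTheorem3 {𝕜 X : Type*} [RCLike 𝕜] [NormedAddCommGroup X] [NormedSpace 𝕜 X]
    [NormedSpace ℝ X] [IsScalarTower ℝ 𝕜 X] [CompleteSpace X]
    (α : ℝ) (hα₁ : 1 < α) (hα₂ : α < 2)
    (A : X →ₗ.[𝕜] X) (S : ℝ → X →L[𝕜] X)
    (hS : FractionalResolvent.IsResolventFamily α A S)
    (r : ℝ) (hr : 0 < r)
    (hSV : FractionalResolvent.HasBoundedSemivariation S 0 r) :
    (∀ t ∈ Set.Icc (0 : ℝ) r,
      Set.range (FractionalResolvent.resolventP α S t) ⊆ (A.domain : Set X)) ∧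
    ∃ AP : ℝ → X →L[𝕜] X,
      (∀ t ∈ Set.Icc (0 : ℝ) r, ∀ x : X,
        ∃ h : FractionalResolvent.resolventP α S t x ∈ A.domain,
          A ⟨FractionalResolvent.resolventP α S t x, h⟩ = AP t x) ∧
      BddAbove ((fun t : ℝ => ‖(t : 𝕜) • AP t‖) '' Set.Icc (0 : ℝ) r) :=
  mainTheorem3_general hα₁ hS hSV
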